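/- A directed graph $E=(E^0,E^1,r_E,s_E)$ consists of arbitrary sets $E^0$ of vertices and $E^1$ of edges with range and source maps $r_E,s_E:E^1\to E^0$. A path of length $n\ge 1$ is a sequence $\alpha=e_1\cdots e_n$ of edges with $r_E(e_i)=s_E(e_{i+1})$; vertices are the paths of length $0$. Write $v\ge w$ if there is a path (possibly of length $0$) from $v$ to $w$. A set $H\subseteq E^0$ is hereditary if $v\in H$ and $v\ge w$ imply $w\in H$. A vertex $v$ is regular if $s_E^{-1}(v)$ is finite and non-empty. A cycle is a path $e_1\cdots e_n$, $n\geq 1$, with $r_E(e_n)=s_E(e_1)$ and $s_E(e_i)\ne s_E(e_j)$ for $i\neq j$; a graph without cycles is acyclic, and a graph is finite if it has finitely many vertices and edges. For a commutative ring $R$ with unit, the Leavitt path algebra $L_R(E)$ is the universal (associative, not necessarily unital) $R$-algebra generated by pairwise orthogonal idempotents $v$ ($v\in E^0$) and elements $e,e^*$ ($e\in E^1$) subject to: $s_E(e)e=e=e\,r_E(e)$ and $r_E(e)e^*=e^*=e^*s_E(e)$ for all $e\in E^1$; $e^*e=r_E(e)$ for all $e\in E^1$, and $e^*f=0$ for $e\ne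 f$ in $E^1$; and $v=\sum_{s_E(e)=v}ee^*$ for every regular vertex $v$. For a hereditary set $H\subseteq E^0$ let $F(H)$ be the set of paths $\alpha=e_1\cdots e_n$ in $E$ with $n\geq 1$, $s_E(e_n)\notin H$ and $r_E(e_n)\in H$, and let $\overline F(H)=\{\overline\alpha:\alpha\in F(H)\}$ be a copy of $F(H)$. The graph $E(H)$ has vertex set $H\sqcup F(H)$ and edge set $s_E^{-1}(H)\sqcup\overline F(H)$; an edge $e\in s_E^{-1}(H)$ keeps its source $s_E(e)$ and range $r_E(e)$, while $\overline\alpha$ has source $\alpha$ and range $r_E(\alpha)=r_E(e_n)$. **Theorem.** Let $R$ be a commutative ring with unit, $E$ a directed graph and $H\subseteq E^0$ a hereditary subset. Suppose that the graph $(E^0\setminus H,\ r_E^{-1}(E^0\setminus H),\ r_E,\ s_E)$ is finite and acyclic, that for every $v\in E^0\setminus H$ there is some $w\in H$ with $v\ge w$, and that the set $s_E^{-1}(E^0\setminus H)\cap r_E^{-1}(H)$ is finite. Then $L_R(E)\cong L_R(E(H))$ as $R$-algebras. -/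

import Mathlib

universe u v w

/-- A directed graph `E = (E⁰, E¹, r, s)`: arbitrary sets of vertices and edges (loops and multiple
edges are allowed) with range and source maps. -/
structure DirectedGraph where
  /-- the vertices -/
  Vertex : Type u
  /-- the edges -/
  Edge : Type v
  /-- the source of an edge -/
  source : Edge → Vertex
  /-- the range of an edge -/
  range : Edge → Vertex

namespace DirectedGraph

section Paths

variable (E : DirectedGraph.{u, v})

/-- `E.IsPath x l y`: the finite sequence of edges `l = e₁ … eₙ` is a path from `x` to `y`, i.e.
`s(e₁) = x`, `r(eᵢ) = s(eᵢ₊₁)` and `r(eₙ) = y`; the empty sequence is the path of length `0` at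
the vertex `x = y`. -/
def IsPath : E.Vertex → List E.Edge → E.Vertex → Prop
  | x, [], y => x = y
  | x, e :: l, y => E.source e = x ∧ IsPath (E.range e) l y

/-- `x ≥ y`: there is a finite path (possibly of length `0`) from `x` to `y`. -/
def Reaches (x y : E.Vertex) : Prop := ∃ l : List E.Edge, E.IsPath x l y

/-- A cycle: a closed path `e₁ … eₙ`, `n ≥ 1`, with `s(eᵢ) ≠ s(eⱼ)` for `i ≠ j`. -/
def IsCycle (l : List E.Edge) : Prop :=
  l ≠ [] ∧ (∃ x, E.IsPath x l x) ∧ (l.map E.source).Nodup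

/-- A graph is acyclic if it has no cycles. -/
def IsAcyclic : Prop := ∀ l : List E.Edge, ¬ E.IsCycle l

/-- A graph is finite if it has finitely many vertices and finitely many edges. -/
def IsFinite : Prop := Finite E.Vertex ∧ Finite E.Edge

/-- A vertex is regular if it emits at least one and only finitely many edges. -/
def IsRegular (x : E.Vertex) : Prop :=
  {e : E.Edge | E.source e = x}.Finite ∧ {e : E.Edge | E.source e = x}.Nonempty

/-- A set of vertices is hereditary if it contains every vertex reached from one of its members. -/
def IsHereditary (H : Set E.Vertex) : Prop := ∀ x ∈ H, ∀ y, E.Reaches x y → y ∈ H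

variable {E}

theorem IsHereditary.range_mem {H : Set E.Vertex} (hH : E.IsHereditary H) {e : E.Edge}
    (he : E.source e ∈ H) : E.range e ∈ H :=
  hH _ he _ ⟨[e], rfl, rfl⟩

/-- The graph `(E⁰ \ H, r⁻¹(E⁰ \ H), r, s)`; since `H` is hereditary, an edge whose range is outside
`H` has its source outside `H`. -/
def outside (H : Set E.Vertex) (hH : E.IsHereditary H) : DirectedGraph.{u, v} where
  Vertex := {x : E.Vertex // x ∉ H}
  Edge := {e : E.Edge // E.range e ∉ H}
  source e := ⟨E.source e.1, fun h => e.2 (hH.range_mem h)⟩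
  range e := ⟨E.range e.1, e.2⟩

/-- `F(H)`: the paths `e₁ … eₙ` in `E` of length `n ≥ 1` with `s(eₙ) ∉ H` and `r(eₙ) ∈ H`. -/
@[ext]
structure EnteringPath (H : Set E.Vertex) where
  /-- the edges `e₁, …, eₙ` of the path -/
  edges : List E.Edge
  ne_nil : edges ≠ []
  isPath : ∃ x y, E.IsPath x edges y
  source_last : E.source (edges.getLast ne_nil) ∉ H
  range_last : E.range (edges.getLast ne_nil) ∈ H

/-- The graph `E(H)`: its vertices are the disjoint union of `H` and `F(H)`, its edges the disjoint
union of `s⁻¹(H)` and a copy `{ᾱ | α ∈ F(H)}` of `F(H)`. Edges in `s⁻¹(H)` keep their source and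
range; `ᾱ` runs from the vertex `α` to the range of the path `α`. -/
def enteringGraph (H : Set E.Vertex) (hH : E.IsHereditary H) : DirectedGraph.{max u v, v} where
  Vertex := {x : E.Vertex // x ∈ H} ⊕ EnteringPath H
  Edge := {e : E.Edge // E.source e ∈ H} ⊕ EnteringPath H
  source
    | .inl e => .inl ⟨E.source e.1, e.2⟩
    | .inr α => .inr α
  range
    | .inl e => .inl ⟨E.range e.1, hH.range_mem e.2⟩
    | .inr α => .inl ⟨E.range (α.edges.getLast α.ne_nil), α.range_last⟩

end Paths

/-- A Cuntz–Krieger `E`-family in a (not necessarily unital) ring `A`: pairwise orthogonal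
idempotents `p x` (`x ∈ E⁰`) and elements `s e`, `t e` (`e ∈ E¹`, with `t e` in the role of `e*`)
that satisfy the defining relations of the Leavitt path algebra. -/
structure IsCuntzKriegerFamily (E : DirectedGraph.{u, v}) {A : Type*} [NonUnitalRing A]
    (p : E.Vertex → A) (s t : E.Edge → A) : Prop where
  idem : ∀ x, p x * p x = p x
  orth : ∀ x y, x ≠ y → p x * p y = 0
  source_mul : ∀ e, p (E.source e) * s e = s e
  mul_range : ∀ e, s e * p (E.range e) = s e
  range_mul : ∀ e, p (E.range e) * t e = t e
  mul_source : ∀ e, t e * p (E.source e) = t e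
  ck1_self : ∀ e, t e * s e = p (E.range e)
  ck1_ne : ∀ e f, e ≠ f → t e * s f = 0
  ck2 : ∀ x (hx : E.IsRegular x), p x = ∑ e ∈ hx.1.toFinset, s e * t e

end DirectedGraph

open DirectedGraph

/-- The symbols that generate the Leavitt path algebra: the vertices `x`, the edges `e` and the
ghost edges `e*`. -/
inductive LeavittSymbol (E : DirectedGraph.{u, v}) : Type (max u v)
  | vertex (x : E.Vertex)
  | edge (e : E.Edge)
  | ghost (e : E.Edge)

/-- The free (associative, non-unital) `R`-algebra on the vertices, edges and ghost edges. -/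
abbrev FreeLeavitt (R : Type w) [CommRing R] (E : DirectedGraph.{u, v}) : Type (max u v w) :=
  MonoidAlgebra R (FreeSemigroup (LeavittSymbol E))

/-- A symbol as an element of the free algebra. -/
noncomputable abbrev FreeLeavitt.of (R : Type w) [CommRing R] {E : DirectedGraph.{u, v}}
    (a : LeavittSymbol E) : FreeLeavitt R E :=
  MonoidAlgebra.single (FreeSemigroup.of a) 1

section Relations

variable (R : Type w) [CommRing R] {E : DirectedGraph.{u, v}}

open FreeLeavitt LeavittSymbol

/-- The defining relations of the Leavitt path algebra, in the free algebra. -/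
inductive LeavittRel : FreeLeavitt R E → FreeLeavitt R E → Prop
  | idem (x : E.Vertex) : LeavittRel (of R (vertex x) * of R (vertex x)) (of R (vertex x))
  | orth (x y : E.Vertex) (h : x ≠ y) : LeavittRel (of R (vertex x) * of R (vertex y)) 0
  | source_mul (e : E.Edge) : LeavittRel (of R (vertex (E.source e)) * of R (edge e)) (of R (edge e))
  | mul_range (e : E.Edge) : LeavittRel (of R (edge e) * of R (vertex (E.range e))) (of R (edge e))
  | range_mul (e : E.Edge) : LeavittRel (of R (vertex (E.range e)) * of R (ghost e)) (of R (ghost e))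
  | mul_source (e : E.Edge) : LeavittRel (of R (ghost e) * of R (vertex (E.source e))) (of R (ghost e))
  | ck1_self (e : E.Edge) : LeavittRel (of R (ghost e) * of R (edge e)) (of R (vertex (E.range e)))
  | ck1_ne (e f : E.Edge) (h : e ≠ f) : LeavittRel (of R (ghost e) * of R (edge f)) 0
  | ck2 (x : E.Vertex) (hx : E.IsRegular x) :
      LeavittRel (of R (vertex x)) (∑ e ∈ hx.1.toFinset, of R (edge e) * of R (ghost e))

/-- The scalar multiples of the defining relations: the ring congruence that they generate is the
`R`-algebra congruence generated by the defining relations. -/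
inductive LeavittScalarRel : FreeLeavitt R E → FreeLeavitt R E → Prop
  | smul (c : R) {a b : FreeLeavitt R E} (h : LeavittRel R a b) : LeavittScalarRel (c • a) (c • b)

end Relations

/-- The Leavitt path algebra `L_R(E)`: the free (non-unital) `R`-algebra on the vertices, edges and
ghost edges, modulo the defining relations. -/
def LeavittPathAlgebra (R : Type w) [CommRing R] (E : DirectedGraph.{u, v}) : Type (max u v w) :=
  (ringConGen (LeavittScalarRel R (E := E))).Quotient

namespace LeavittPathAlgebra

variable (R : Type w) [CommRing R] (E : DirectedGraph.{u, v})

noncomputable instance : NonUnitalRing (LeavittPathAlgebra R E) :=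
  inferInstanceAs (NonUnitalRing (ringConGen (LeavittScalarRel R (E := E))).Quotient)

/-- The quotient map from the free algebra. -/
noncomputable def mk : FreeLeavitt R E →ₙ+* LeavittPathAlgebra R E where
  toFun a := (ringConGen (LeavittScalarRel R (E := E))).toQuotient a
  map_mul' _ _ := rfl
  map_zero' := rfl
  map_add' _ _ := rfl

theorem mk_surjective : Function.Surjective (mk R E) := Quotient.mk''_surjective

variable {R E} in
theorem smul_rel (c : R) {a b : FreeLeavitt R E}
    (h : ringConGen (LeavittScalarRel R (E := E)) a b) :
    ringConGen (LeavittScalarRel R (E := E)) (c • a) (c • b) := by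
  change RingConGen.Rel _ _ _ at h
  change RingConGen.Rel _ _ _
  induction h with
  | of x y h =>
    obtain ⟨d, h⟩ := h
    rw [smul_smul, smul_smul]
    exact .of _ _ (.smul _ h)
  | refl x => exact .refl _
  | symm _ ih => exact .symm ih
  | trans _ _ ih₁ ih₂ => exact .trans ih₁ ih₂
  | add _ _ ih₁ ih₂ => rw [smul_add, smul_add]; exact .add ih₁ ih₂
  | mul _ h₂ ih₁ _ => rw [← smul_mul_assoc, ← smul_mul_assoc]; exact .mul ih₁ h₂

noncomputable instance : SMul R (LeavittPathAlgebra R E) where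
  smul c := Quotient.map' (c • ·) fun _ _ h => smul_rel c h

noncomputable instance : Module R (LeavittPathAlgebra R E) :=
  (mk_surjective R E).module R (mk R E).toAddMonoidHom fun _ _ => rfl

theorem mk_smul (c : R) (a : FreeLeavitt R E) : mk R E (c • a) = c • mk R E a := rfl

instance : IsScalarTower R (LeavittPathAlgebra R E) (LeavittPathAlgebra R E) where
  smul_assoc c a b := by
    obtain ⟨a, rfl⟩ := mk_surjective R E a
    obtain ⟨b, rfl⟩ := mk_surjective R E b
    simp only [smul_eq_mul, ← mk_smul, ← map_mul, smul_mul_assoc]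

instance : SMulCommClass R (LeavittPathAlgebra R E) (LeavittPathAlgebra R E) where
  smul_comm c a b := by
    obtain ⟨a, rfl⟩ := mk_surjective R E a
    obtain ⟨b, rfl⟩ := mk_surjective R E b
    simp only [smul_eq_mul, ← mk_smul, ← map_mul, mul_smul_comm]

/-- The vertex `x` in `L_R(E)`. -/
noncomputable def vertex (x : E.Vertex) : LeavittPathAlgebra R E :=
  mk R E (FreeLeavitt.of R (.vertex x))

/-- The edge `e` in `L_R(E)`. -/
noncomputable def edge (e : E.Edge) : LeavittPathAlgebra R E :=
  mk R E (FreeLeavitt.of R (.edge e))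

/-- The ghost edge `e*` in `L_R(E)`. -/
noncomputable def ghost (e : E.Edge) : LeavittPathAlgebra R E :=
  mk R E (FreeLeavitt.of R (.ghost e))

variable {R E} in
theorem mk_eq {a b : FreeLeavitt R E} (h : LeavittRel R a b) : mk R E a = mk R E b := by
  refine (RingCon.eq _).2 (.of _ _ ?_)
  simpa only [one_smul] using LeavittScalarRel.smul (1 : R) h

/-- The generators of `L_R(E)` form a Cuntz–Krieger `E`-family. -/
theorem isCuntzKriegerFamily :
    E.IsCuntzKriegerFamily (vertex R E) (edge R E) (ghost R E) where
  idem x := by simpa only [vertex, edge, ghost, map_mul] using mk_eq (.idem x)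
  orth x y h := by simpa only [vertex, edge, ghost, map_mul, map_zero] using mk_eq (.orth x y h)
  source_mul e := by simpa only [vertex, edge, ghost, map_mul] using mk_eq (.source_mul e)
  mul_range e := by simpa only [vertex, edge, ghost, map_mul] using mk_eq (.mul_range e)
  range_mul e := by simpa only [vertex, edge, ghost, map_mul] using mk_eq (.range_mul e)
  mul_source e := by simpa only [vertex, edge, ghost, map_mul] using mk_eq (.mul_source e)
  ck1_self e := by simpa only [vertex, edge, ghost, map_mul] using mk_eq (.ck1_self e)
  ck1_ne e f h := by simpa only [vertex, edge, ghost, map_mul, map_zero] using mk_eq (.ck1_ne e f h)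
  ck2 x hx := by simpa only [vertex, edge, ghost, map_mul, map_sum] using mk_eq (.ck2 x hx)

/-- The universal property of `L_R(E)`: a Cuntz–Krieger `E`-family in an `R`-algebra is the image
of the generators under exactly one `R`-algebra homomorphism. -/
theorem existsUnique_lift {A : Type*} [NonUnitalRing A] [Module R A] [IsScalarTower R A A]
    [SMulCommClass R A A] {p : E.Vertex → A} {s t : E.Edge → A}
    (h : E.IsCuntzKriegerFamily p s t) :
    ∃! φ : LeavittPathAlgebra R E →ₙₐ[R] A, (∀ x, φ (vertex R E x) = p x) ∧
      (∀ e, φ (edge R E e) = s e) ∧ ∀ e, φ (ghost R E e) = t e := by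
  let g : LeavittSymbol E → A
    | .vertex x => p x
    | .edge e => s e
    | .ghost e => t e
  let f : FreeLeavitt R E →ₙₐ[R] A := MonoidAlgebra.liftMagma R (FreeSemigroup.lift g)
  have hf : ∀ a, f (FreeLeavitt.of R a) = g a := fun a => by
    simp [f, FreeLeavitt.of, MonoidAlgebra.liftMagma]
  have hrel : ∀ a b, LeavittRel R a b → f a = f b := by
    intro a b hab
    cases hab <;> simp only [map_mul, map_zero, map_sum, hf, g]
    · exact h.idem _
    · exact h.orth _ _ ‹_›
    · exact h.source_mul _
    · exact h.mul_range _
    · exact h.range_mul _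
    · exact h.mul_source _
    · exact h.ck1_self _
    · exact h.ck1_ne _ _ ‹_›
    · exact h.ck2 _ ‹_›
  have hcon : ∀ a b, RingConGen.Rel (LeavittScalarRel R (E := E)) a b → f a = f b := by
    intro a b hab
    induction hab with
    | of x y hxy => obtain ⟨c, hxy⟩ := hxy; rw [map_smul, map_smul, hrel _ _ hxy]
    | refl x => rfl
    | symm _ ih => exact ih.symm
    | trans _ _ ih₁ ih₂ => exact ih₁.trans ih₂
    | add _ _ ih₁ ih₂ => rw [map_add, map_add, ih₁, ih₂]
    | mul _ _ ih₁ ih₂ => rw [map_mul, map_mul, ih₁, ih₂]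
  let F : LeavittPathAlgebra R E → A := Quotient.lift f hcon
  have hF : ∀ a, F (mk R E a) = f a := fun _ => rfl
  refine ⟨{ toFun := F, map_smul' := ?_, map_zero' := ?_, map_add' := ?_, map_mul' := ?_ },
    ⟨fun x => hf _, fun x => hf _, fun x => hf _⟩, ?_⟩
  · intro c a
    obtain ⟨a, rfl⟩ := mk_surjective R E a
    exact map_smul f c a
  · exact map_zero f
  · intro a b
    obtain ⟨a, rfl⟩ := mk_surjective R E a
    obtain ⟨b, rfl⟩ := mk_surjective R E b
    exact map_add f a b
  · intro a b
    obtain ⟨a, rfl⟩ := mk_surjective R E a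
    obtain ⟨b, rfl⟩ := mk_surjective R E b
    exact map_mul f a b
  · rintro ψ ⟨h₁, h₂, h₃⟩
    let q : FreeLeavitt R E →ₙₐ[R] LeavittPathAlgebra R E :=
      { toFun := mk R E, map_smul' := mk_smul R E, map_zero' := map_zero _,
        map_add' := map_add _, map_mul' := map_mul _ }
    have key : ψ.comp q = f := by
      refine (MonoidAlgebra.liftMagma R).symm.injective (FreeSemigroup.hom_ext ?_)
      funext a
      refine Eq.trans ?_ (hf a).symm
      cases a with
      | vertex x => exact h₁ x
      | edge e => exact h₂ e
      | ghost e => exact h₃ e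
    ext a
    obtain ⟨a, rfl⟩ := mk_surjective R E a
    exact DFunLike.congr_fun key a

end LeavittPathAlgebra

/-! The vertices of E(H) are exactly the paths q that stop on first entering H, those of length 0
being the vertices in H. Both isomorphisms rest on reading the vertex q of E(H) as the projection q
q* of L(E) and the edge ᾱ as the path α.

From E(H) to L(E): no such path is a proper initial segment of another, so the elements q q* are
pairwise orthogonal idempotents, and they form an E(H)-family (`isCuntzKriegerFamily_path`).

From E to L(E(H)): a vertex x goes to the sum of the vertices q that start at x, and an edge e with
source outside H goes to the sum of (eq)‾ q̄* over the q that start at r(e), where q̄ means q itself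
if q has length 0. This is an E-family (`isCuntzKriegerFamily_sum`): prepending e matches the pairs
(e, q) with the paths that start at s(e) (`bijective_cons`).

The sums are finite because outside H the graph is finite and acyclic and every vertex is regular;
reaching H supplies an outgoing edge, and only finitely many edges enter H. The same facts let (CK2)
be iterated until every branch lies in H, which gives x = ∑ q q* in L(E) (`sum_pathVertex`). With
this identity the two homomorphisms are inverse to each other on generators. -/

namespace DirectedGraph

/-! ### Paths into H and their decomposition by the first edge -/

section Entry

variable {E : DirectedGraph.{u, v}} {H : Set E.Vertex}

/-- The vertices of `E(H)`: the paths that enter `H` at their last vertex, where the vertices in `H`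
count as such paths of length `0`. -/
abbrev Entry (H : Set E.Vertex) := {x : E.Vertex // x ∈ H} ⊕ EnteringPath H

/-- The first vertex of a path into `H`. -/
def entryStart : Entry H → E.Vertex
  | .inl x => x
  | .inr α => E.source (α.edges.head α.ne_nil)

/-- The last vertex of a path into `H`. -/
def entryFinish : Entry H → {x : E.Vertex // x ∈ H}
  | .inl x => x
  | .inr α => ⟨E.range (α.edges.getLast α.ne_nil), α.range_last⟩

/-- The edges of a path into `H`. -/
def entryEdges : Entry H → List E.Edge
  | .inl _ => []
  | .inr α => α.edges

/-- The paths into `H` that start at `x`. -/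
abbrev EntryFrom (H : Set E.Vertex) (x : E.Vertex) := {q : Entry H // entryStart q = x}

theorem IsPath.start_eq {x y : E.Vertex} {l : List E.Edge} (h : E.IsPath x l y) (hl : l ≠ []) :
    E.source (l.head hl) = x := by
  cases l with
  | nil => exact absurd rfl hl
  | cons e l => exact h.1

theorem IsPath.append {x y z : E.Vertex} {l m : List E.Edge} (h : E.IsPath x l y)
    (h' : E.IsPath y m z) : E.IsPath x (l ++ m) z := by
  induction l generalizing x with
  | nil => obtain rfl : x = y := h; exact h'
  | cons e l ih => exact ⟨h.1, ih h.2⟩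

theorem IsPath.of_append {x z : E.Vertex} {l m : List E.Edge} (h : E.IsPath x (l ++ m) z) :
    ∃ y, E.IsPath x l y ∧ E.IsPath y m z := by
  induction l generalizing x with
  | nil => exact ⟨x, rfl, h⟩
  | cons e l ih => obtain ⟨y, h₁, h₂⟩ := ih h.2; exact ⟨y, ⟨h.1, h₁⟩, h₂⟩

theorem IsPath.source_mem (hH : E.IsHereditary H) {x y : E.Vertex} {l : List E.Edge}
    (h : E.IsPath x l y) (hx : x ∈ H) : ∀ e ∈ l, E.source e ∈ H := by
  induction l generalizing x with
  | nil => simp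
  | cons e l ih =>
    have he : E.source e ∈ H := h.1 ▸ hx
    intro f hf
    rcases List.mem_cons.1 hf with rfl | hf
    · exact he
    · exact ih h.2 (hH.range_mem he) f hf

/-- The path `e q` for a path `q` into `H` that starts at the range of `e`. -/
def EnteringPath.cons (e : E.Edge) (he : E.source e ∉ H) :
    (q : Entry H) → entryStart q = E.range e → EnteringPath H
  | .inl x, hx =>
    { edges := [e]
      ne_nil := List.cons_ne_nil _ _
      isPath := ⟨_, _, rfl, rfl⟩
      source_last := he
      range_last := by
        have hx : (x : E.Vertex) = E.range e := hx
        exact hx ▸ x.2 }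
  | .inr α, hα =>
    { edges := e :: α.edges
      ne_nil := List.cons_ne_nil _ _
      isPath := by
        obtain ⟨x, y, h⟩ := α.isPath
        obtain rfl : x = E.range e := (h.start_eq α.ne_nil).symm.trans hα
        exact ⟨_, y, rfl, h⟩
      source_last := by rw [List.getLast_cons α.ne_nil]; exact α.source_last
      range_last := by rw [List.getLast_cons α.ne_nil]; exact α.range_last }

theorem EnteringPath.cons_edges (e : E.Edge) (he : E.source e ∉ H) (q : Entry H)
    (hq : entryStart q = E.range e) : (EnteringPath.cons e he q hq).edges = e :: entryEdges q := by
  cases q <;> rfl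

theorem entryStart_cons (e : E.Edge) (he : E.source e ∉ H) (q : Entry H)
    (hq : entryStart q = E.range e) :
    entryStart (.inr (EnteringPath.cons e he q hq)) = E.source e := by
  cases q <;> rfl

theorem entryFinish_cons (e : E.Edge) (he : E.source e ∉ H) (q : Entry H)
    (hq : entryStart q = E.range e) :
    entryFinish (.inr (EnteringPath.cons e he q hq)) = entryFinish q := by
  cases q with
  | inl x => exact Subtype.ext hq.symm
  | inr α =>
    refine Subtype.ext (congrArg E.range ?_)
    exact List.getLast_cons α.ne_nil

theorem entry_ext {q q' : Entry H} (h₁ : entryStart q = entryStart q')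
    (h₂ : entryEdges q = entryEdges q') : q = q' := by
  rcases q with x | α <;> rcases q' with y | β
  · exact congrArg _ (Subtype.ext h₁)
  · exact absurd h₂.symm β.ne_nil
  · exact absurd h₂ α.ne_nil
  · exact congrArg _ (EnteringPath.ext h₂)

theorem EnteringPath.cons_inj {e f : E.Edge} {he : E.source e ∉ H} {hf : E.source f ∉ H}
    {q q' : Entry H} {hq : entryStart q = E.range e} {hq' : entryStart q' = E.range f}
    (h : EnteringPath.cons e he q hq = EnteringPath.cons f hf q' hq') : e = f ∧ q = q' := by
  have h := congrArg EnteringPath.edges h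
  rw [cons_edges, cons_edges] at h
  obtain ⟨rfl, h'⟩ := List.cons.inj h
  exact ⟨rfl, entry_ext (hq.trans hq'.symm) h'⟩

/-- If the first edge started in H, heredity would put every later source in H, including that of
the last edge. So the first edge starts outside H and the remainder is again a path into H, possibly
of length 0. -/
theorem EnteringPath.exists_cons (hH : E.IsHereditary H) (α : EnteringPath H) :
    ∃ e he q hq, α = EnteringPath.cons e he q hq := by
  obtain ⟨l, hl, ⟨x, y, hp⟩, hs, hr⟩ := α
  cases l with
  | nil => exact absurd rfl hl
  | cons e l =>
    have he : E.source e ∉ H := fun he =>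
      hs (hp.source_mem hH (hp.1 ▸ he) _ (List.getLast_mem hl))
    by_cases h : l = []
    · subst h
      exact ⟨e, he, .inl ⟨E.range e, hr⟩, rfl, rfl⟩
    · rw [List.getLast_cons h] at hs
      simp only [List.getLast_cons h] at hr
      exact ⟨e, he, .inr ⟨l, h, ⟨_, _, hp.2⟩, hs, hr⟩, hp.2.start_eq h, rfl⟩

theorem entryStart_notMem (hH : E.IsHereditary H) (α : EnteringPath H) :
    entryStart (.inr α) ∉ H := by
  obtain ⟨e, he, q, hq, rfl⟩ := α.exists_cons hH
  rwa [entryStart_cons]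

/-- Induction on the length, by stripping the first edge; the identities for products along paths
use it. -/
theorem entry_induction (hH : E.IsHereditary H) {P : Entry H → Prop} (vertex : ∀ x, P (.inl x))
    (cons : ∀ e he q hq, P q → P (.inr (EnteringPath.cons e he q hq))) (q : Entry H) : P q := by
  induction hn : (entryEdges q).length generalizing q with
  | zero =>
    rcases q with x | α
    · exact vertex x
    · exact absurd (List.length_eq_zero_iff.1 hn) α.ne_nil
  | succ n ih =>
    rcases q with x | α
    · exact vertex x
    · obtain ⟨e, he, q, hq, rfl⟩ := α.exists_cons hH
      refine cons e he q hq (ih q ?_)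
      rw [entryEdges, EnteringPath.cons_edges, List.length_cons] at hn
      omega

theorem eq_inl_of_entryStart (hH : E.IsHereditary H) {q : Entry H} {x : E.Vertex} (hx : x ∈ H)
    (hq : entryStart q = x) : q = .inl ⟨x, hx⟩ := by
  rcases q with y | α
  · exact congrArg _ (Subtype.ext hq)
  · exact absurd (hq ▸ hx) (entryStart_notMem hH α)

theorem sum_entryFrom_of_mem (hH : E.IsHereditary H) {M : Type*} [AddCommMonoid M] {x : E.Vertex}
    [Fintype (EntryFrom H x)] (hx : x ∈ H) (f : Entry H → M) :
    ∑ q : EntryFrom H x, f q = f (.inl ⟨x, hx⟩) := by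
  refine Fintype.sum_eq_single (⟨.inl ⟨x, hx⟩, rfl⟩ : EntryFrom H x) fun q hq => ?_
  exact absurd (Subtype.ext (eq_inl_of_entryStart hH hx q.2)) hq

/-- A path into H from a vertex outside H has positive length, hence a unique first edge and a
unique remainder. Both the finiteness of the sums and their compatibility with (CK2) come from this
bijection. -/
theorem bijective_cons (hH : E.IsHereditary H) {x : E.Vertex} (hx : x ∉ H) (s : Set E.Edge)
    (hs : ∀ e, e ∈ s ↔ E.source e = x) :
    Function.Bijective (fun a : Σ e : s, EntryFrom H (E.range e) =>
      (⟨.inr (EnteringPath.cons a.1.1 (((hs _).1 a.1.2).symm ▸ hx) a.2.1 a.2.2),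
        (entryStart_cons _ _ _ _).trans ((hs _).1 a.1.2)⟩ : EntryFrom H x)) := by
  constructor
  · rintro ⟨⟨e, he⟩, q, hq⟩ ⟨⟨f, hf⟩, q', hq'⟩ h
    obtain ⟨rfl, rfl⟩ := EnteringPath.cons_inj (Sum.inr.inj (congrArg Subtype.val h))
    rfl
  · rintro ⟨y | α, hq⟩
    · exact absurd ((show (y : E.Vertex) = x from hq) ▸ y.2) hx
    · obtain ⟨e, he, q, hq', rfl⟩ := α.exists_cons hH
      exact ⟨⟨⟨e, (hs e).2 ((entryStart_cons e he q hq').symm.trans hq)⟩, q, hq'⟩, rfl⟩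

theorem sum_entryFrom_of_notMem (hH : E.IsHereditary H) {M : Type*} [AddCommMonoid M]
    [∀ x, Fintype (EntryFrom H x)] {x : E.Vertex} (hx : x ∉ H) (s : Finset E.Edge)
    (hs : ∀ e, e ∈ s ↔ E.source e = x) (f : Entry H → M) (g : E.Edge → M)
    (hg : ∀ (e : E.Edge) (he : E.source e = x), g e =
      ∑ q : EntryFrom H (E.range e), f (.inr (EnteringPath.cons e (he.symm ▸ hx) q.1 q.2))) :
    ∑ e ∈ s, g e = ∑ q : EntryFrom H x, f q := by
  rw [← Finset.sum_coe_sort]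
  refine Eq.trans ?_ ((bijective_cons hH hx (s : Set E.Edge) hs).sum_comp fun q => f q)
  rw [Fintype.sum_sigma]
  exact Finset.sum_congr rfl fun e _ => hg e.1 ((hs _).1 e.2)

/-! ### Consequences of finiteness and acyclicity outside H -/

theorem exists_source_eq_of_not_nodup {l : List E.Edge} (h : ¬ (l.map E.source).Nodup) :
    ∃ a e b f c, l = a ++ e :: (b ++ f :: c) ∧ E.source e = E.source f := by
  induction l with
  | nil => exact absurd List.nodup_nil h
  | cons e l ih =>
    rw [List.map_cons, List.nodup_cons, not_and_or, not_not] at h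
    rcases h with h | h
    · obtain ⟨f, hf, hef⟩ := List.mem_map.1 h
      obtain ⟨b, c, rfl⟩ := List.append_of_mem hf
      exact ⟨[], e, b, f, c, rfl, hef.symm⟩
    · obtain ⟨a, e', b, f, c, rfl, hef⟩ := ih h
      exact ⟨e :: a, e', b, f, c, rfl, hef⟩

/-- A cycle must have distinct sources, so arbitrary closed paths need an argument: one that repeats
a source contains a shorter closed path. -/
theorem IsAcyclic.not_isPath (hE : E.IsAcyclic) {x : E.Vertex} {l : List E.Edge} (hl : l ≠ []) :
    ¬ E.IsPath x l x := by
  induction hn : l.length using Nat.strong_induction_on generalizing l x with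
  | _ n ih =>
    intro h
    by_cases hd : (l.map E.source).Nodup
    · exact hE l ⟨hl, ⟨x, h⟩, hd⟩
    obtain ⟨a, e, b, f, c, rfl, hef⟩ := exists_source_eq_of_not_nodup hd
    obtain ⟨y, -, he, h⟩ := h.of_append
    obtain ⟨z, hb, hf, -⟩ := h.of_append
    have hz : E.source e = z := hef.trans hf
    -- The segment from `e` up to just before `f` is closed, and it is shorter because `f` is
    -- dropped.
    refine ih _ ?_ (List.cons_ne_nil e b) rfl (x := z) ⟨hz, hb⟩
    simp only [List.length_append, List.length_cons] at hn ⊢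
    omega

theorem IsAcyclic.wellFounded (hE : E.IsAcyclic) [Finite E.Vertex] :
    WellFounded fun x y : E.Vertex => ∃ e, E.source e = y ∧ E.range e = x := by
  let r : E.Vertex → E.Vertex → Prop := fun x y => ∃ l, l ≠ [] ∧ E.IsPath y l x
  have : IsTrans E.Vertex r := ⟨fun x y z ⟨l, hl, h⟩ ⟨m, _, h'⟩ =>
    ⟨m ++ l, List.append_ne_nil_of_right_ne_nil _ hl, h'.append h⟩⟩
  have : Std.Irrefl r := ⟨fun x ⟨l, hl, h⟩ => hE.not_isPath hl h⟩
  refine Subrelation.wf ?_ (Finite.wellFounded_of_trans_of_irrefl r)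
  rintro x y ⟨e, rfl, rfl⟩
  exact ⟨[e], List.cons_ne_nil _ _, rfl, rfl⟩

/-- Edges outside H form a well-founded relation, so a property can be propagated backwards from H
along edges. -/
theorem induction_outside (hH : E.IsHereditary H) (hfin : (outside H hH).IsFinite)
    (hacyclic : (outside H hH).IsAcyclic) {P : E.Vertex → Prop} (mem : ∀ x ∈ H, P x)
    (notMem : ∀ x ∉ H, (∀ e, E.source e = x → P (E.range e)) → P x) (x : E.Vertex) : P x := by
  by_cases hx : x ∈ H
  · exact mem x hx
  have := hfin.1
  suffices ∀ y : (outside H hH).Vertex, P y.1 from this ⟨x, hx⟩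
  intro y
  induction y using hacyclic.wellFounded.induction with
  | _ y ih =>
    refine notMem y.1 y.2 fun e he => ?_
    by_cases hr : E.range e ∈ H
    · exact mem _ hr
    · exact ih ⟨E.range e, hr⟩ ⟨⟨e, hr⟩, Subtype.ext he, rfl⟩

/-- An edge from x either stays outside H or enters H, and each kind is finite in number. A path
from x to H cannot have length 0, so x emits an edge. -/
theorem isRegular_of_notMem (hH : E.IsHereditary H) (hfin : (outside H hH).IsFinite)
    (hreach : ∀ x, x ∉ H → ∃ y ∈ H, E.Reaches x y)
    (hentering : {e : E.Edge | E.source e ∉ H ∧ E.range e ∈ H}.Finite) {x : E.Vertex}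
    (hx : x ∉ H) : E.IsRegular x := by
  constructor
  · have : Finite {e : E.Edge // E.range e ∉ H} := hfin.2
    refine (Set.Finite.union (s := {e : E.Edge | E.range e ∉ H}) this hentering).subset fun e he => ?_
    have he : E.source e = x := he
    by_cases hr : E.range e ∈ H
    · exact .inr ⟨he ▸ hx, hr⟩
    · exact .inl hr
  · obtain ⟨y, hy, l, hl⟩ := hreach x hx
    cases l with
    | nil => exact absurd ((show x = y from hl) ▸ hy) hx
    | cons e l => exact ⟨e, hl.1⟩

theorem finite_entryFrom (hH : E.IsHereditary H) (hfin : (outside H hH).IsFinite)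
    (hacyclic : (outside H hH).IsAcyclic) (hreg : ∀ x ∉ H, E.IsRegular x) (x : E.Vertex) :
    Finite (EntryFrom H x) := by
  induction x using induction_outside hH hfin hacyclic with
  | mem x hx =>
    have : Subsingleton (EntryFrom H x) := ⟨fun q q' => Subtype.ext <|
      (eq_inl_of_entryStart hH hx q.2).trans (eq_inl_of_entryStart hH hx q'.2).symm⟩
    infer_instance
  | notMem x hx ih =>
    have : Finite {e : E.Edge | E.source e = x} := (hreg x hx).1
    have (e : {e : E.Edge | E.source e = x}) : Finite (EntryFrom H (E.range e)) := ih e e.2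
    exact .of_surjective _ (bijective_cons hH hx {e | E.source e = x} fun _ => .rfl).surjective

/-! ### Vertices of H inside E(H) -/

theorem isRegular_enteringGraph_inl {hH : E.IsHereditary H} {x : {x : E.Vertex // x ∈ H}} :
    (enteringGraph H hH).IsRegular (.inl x) ↔ E.IsRegular x := by
  constructor
  · intro hr
    have hmem {e : E.Edge} (he : E.source e = x) : E.source e ∈ H := he ▸ x.2
    constructor
    · refine ((hr.1.preimage Sum.inl_injective.injOn).image Subtype.val).subset fun e he => ?_
      exact ⟨⟨e, hmem he⟩, congrArg Sum.inl (Subtype.ext he), rfl⟩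
    · obtain ⟨e | α, he⟩ := hr.2
      · exact ⟨e, congrArg Subtype.val (Sum.inl.inj he)⟩
      · exact absurd he Sum.inr_ne_inl
  · intro hx
    constructor
    · refine ((hx.1.preimage Subtype.val_injective.injOn).image Sum.inl).subset ?_
      rintro (e | α) he
      · exact ⟨e, congrArg Subtype.val (Sum.inl.inj he), rfl⟩
      · exact absurd he Sum.inr_ne_inl
    · obtain ⟨e, he⟩ := hx.2
      have he : E.source e = x := he
      exact ⟨.inl ⟨e, he ▸ x.2⟩, congrArg Sum.inl (Subtype.ext he)⟩

/-- Each ᾱ starts at the vertex α in F(H), so a vertex of H emits the same edges in both graphs;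
this transports (CK2) at H in either direction. -/
theorem sum_enteringGraph_inl {hH : E.IsHereditary H} {M : Type*} [AddCommMonoid M]
    {x : {x : E.Vertex // x ∈ H}} (hx : E.IsRegular x)
    (hr : (enteringGraph H hH).IsRegular (.inl x)) {f : E.Edge → M}
    {g : {e : E.Edge // E.source e ∈ H} ⊕ EnteringPath H → M}
    (hfg : ∀ e he, f e = g (.inl ⟨e, he⟩)) :
    ∑ e ∈ hx.1.toFinset, f e = ∑ e ∈ hr.1.toFinset, g e := by
  have hmem {e : E.Edge} (he : e ∈ hx.1.toFinset) : E.source e = x := hx.1.mem_toFinset.1 he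
  refine Finset.sum_bij (fun e he => .inl ⟨e, (hmem he).symm ▸ x.2⟩) ?_ ?_ ?_ ?_
  · exact fun e he => hr.1.mem_toFinset.2 (congrArg Sum.inl (Subtype.ext (hmem he)))
  · exact fun e _ f _ hef => congrArg Subtype.val (Sum.inl.inj hef)
  · rintro (e | α) he
    · exact ⟨e.1, hx.1.mem_toFinset.2
        (congrArg Subtype.val (Sum.inl.inj (hr.1.mem_toFinset.1 he))), rfl⟩
    · exact absurd (hr.1.mem_toFinset.1 he) Sum.inr_ne_inl
  · exact fun e he => hfg e _

end Entry

namespace IsCuntzKriegerFamily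

/-! ### The E-family built from an E(H)-family -/

section Entering

variable {E : DirectedGraph.{u, v}} {H : Set E.Vertex} {hH : E.IsHereditary H} {A : Type*}
  [NonUnitalRing A] {p : Entry H → A} {s t : {e : E.Edge // E.source e ∈ H} ⊕ EnteringPath H → A}

/-- The element of a path into `H`, seen as a path of length at most `1` in `E(H)`. -/
def entry (p : Entry H → A) (s : {e : E.Edge // E.source e ∈ H} ⊕ EnteringPath H → A) :
    Entry H → A
  | .inl x => p (.inl x)
  | .inr α => s (.inr α)

/-- The vertices of `E` in a Cuntz–Krieger `E(H)`-family: `x` is the sum of all paths into `H` that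
start at `x`. -/
def sumVertex [∀ x, Fintype (EntryFrom H x)] (p : Entry H → A) (x : E.Vertex) : A :=
  ∑ q : EntryFrom H x, p q

open Classical in
/-- The edges of `E` in a Cuntz–Krieger `E(H)`-family. -/
noncomputable def sumEdge [∀ x, Fintype (EntryFrom H x)] (p : Entry H → A)
    (s t : {e : E.Edge // E.source e ∈ H} ⊕ EnteringPath H → A) (e : E.Edge) : A :=
  if he : E.source e ∈ H then s (.inl ⟨e, he⟩) else
    ∑ q : EntryFrom H (E.range e), s (.inr (EnteringPath.cons e he q.1 q.2)) * entry p t q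

open Classical in
/-- The ghost edges of `E` in a Cuntz–Krieger `E(H)`-family. -/
noncomputable def sumGhost [∀ x, Fintype (EntryFrom H x)] (p : Entry H → A)
    (s t : {e : E.Edge // E.source e ∈ H} ⊕ EnteringPath H → A) (e : E.Edge) : A :=
  if he : E.source e ∈ H then t (.inl ⟨e, he⟩) else
    ∑ q : EntryFrom H (E.range e), entry p s q * t (.inr (EnteringPath.cons e he q.1 q.2))

theorem vertex_mul_entry (h : (enteringGraph H hH).IsCuntzKriegerFamily p s t) (q : Entry H) :
    p q * entry p s q = entry p s q := by
  rcases q with x | α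
  · exact h.idem (.inl x)
  · exact h.source_mul (.inr α)

theorem entry_mul_vertex (h : (enteringGraph H hH).IsCuntzKriegerFamily p s t) (q : Entry H) :
    entry p t q * p q = entry p t q := by
  rcases q with x | α
  · exact h.idem (.inl x)
  · exact h.mul_source (.inr α)

theorem ghostEntry_mul_entry (h : (enteringGraph H hH).IsCuntzKriegerFamily p s t) (q : Entry H) :
    entry p t q * entry p s q = p (.inl (entryFinish q)) := by
  rcases q with x | α
  · exact h.idem (.inl x)
  · exact h.ck1_self (.inr α)

/-- Each factor absorbs its own vertex of E(H), and distinct vertices are orthogonal. -/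
theorem ghostEntry_mul_entry_of_ne (h : (enteringGraph H hH).IsCuntzKriegerFamily p s t)
    {q q' : Entry H} (hq : q ≠ q') : entry p t q * entry p s q' = 0 := by
  rw [← entry_mul_vertex h, ← vertex_mul_entry h q', mul_assoc, ← mul_assoc (p q),
    h.orth q q' hq, zero_mul, mul_zero]

/-- The vertex α in F(H) emits ᾱ and nothing else, so it is regular and (CK2) there has a single
term. -/
theorem entry_mul_ghostEntry (h : (enteringGraph H hH).IsCuntzKriegerFamily p s t) (q : Entry H) :
    entry p s q * entry p t q = p q := by
  rcases q with x | α
  · exact h.idem (.inl x)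
  · have hs : {e | (enteringGraph H hH).source e = .inr α} = {.inr α} := by
      ext (e | β)
      · exact iff_of_false Sum.inl_ne_inr Sum.inl_ne_inr
      · exact Sum.inr_injective.eq_iff.trans Sum.inr_injective.eq_iff.symm
    have hr : (enteringGraph H hH).IsRegular (.inr α) := by
      exact ⟨hs ▸ Set.finite_singleton _, hs ▸ Set.singleton_nonempty _⟩
    rw [h.ck2 _ hr, Finset.sum_eq_single_of_mem (.inr α) (hr.1.mem_toFinset.2 rfl)]
    · rfl
    · intro e he hne
      exact absurd (hs.le (hr.1.mem_toFinset.1 he)) hne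

theorem edge_cons_mul_vertex (h : (enteringGraph H hH).IsCuntzKriegerFamily p s t) {e : E.Edge}
    (he : E.source e ∉ H) (q : Entry H) (hq : entryStart q = E.range e) :
    s (.inr (EnteringPath.cons e he q hq)) * p (.inl (entryFinish q)) =
      s (.inr (EnteringPath.cons e he q hq)) := by
  rw [← entryFinish_cons e he q hq]
  exact h.mul_range (.inr (EnteringPath.cons e he q hq))

theorem ghost_cons_mul_edge_cons (h : (enteringGraph H hH).IsCuntzKriegerFamily p s t)
    {e : E.Edge} (he : E.source e ∉ H) (q : Entry H) (hq : entryStart q = E.range e) :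
    t (.inr (EnteringPath.cons e he q hq)) * s (.inr (EnteringPath.cons e he q hq)) =
      p (.inl (entryFinish q)) := by
  rw [← entryFinish_cons e he q hq]
  exact h.ck1_self (.inr (EnteringPath.cons e he q hq))

theorem vertex_finish_mul_ghostEntry (h : (enteringGraph H hH).IsCuntzKriegerFamily p s t)
    (q : Entry H) : p (.inl (entryFinish q)) * entry p t q = entry p t q := by
  rcases q with x | α
  · exact h.idem (.inl x)
  · exact h.range_mul (.inr α)

variable [∀ x, Fintype (EntryFrom H x)]

theorem sumEdge_of_mem {e : E.Edge} (he : E.source e ∈ H) :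
    sumEdge p s t e = s (.inl ⟨e, he⟩) := dif_pos he

theorem sumEdge_of_notMem {e : E.Edge} (he : E.source e ∉ H) : sumEdge p s t e =
    ∑ q : EntryFrom H (E.range e), s (.inr (EnteringPath.cons e he q.1 q.2)) * entry p t q :=
  dif_neg he

theorem sumGhost_of_mem {e : E.Edge} (he : E.source e ∈ H) :
    sumGhost p s t e = t (.inl ⟨e, he⟩) := dif_pos he

theorem sumGhost_of_notMem {e : E.Edge} (he : E.source e ∉ H) : sumGhost p s t e =
    ∑ q : EntryFrom H (E.range e), entry p s q * t (.inr (EnteringPath.cons e he q.1 q.2)) :=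
  dif_neg he

theorem vertex_mul_sumVertex (h : (enteringGraph H hH).IsCuntzKriegerFamily p s t) {q : Entry H}
    {x : E.Vertex} (hq : entryStart q = x) : p q * sumVertex p x = p q := by
  rw [sumVertex, Finset.mul_sum, Finset.sum_eq_single_of_mem ⟨q, hq⟩ (Finset.mem_univ _)]
  · exact h.idem q
  · intro q' _ hne
    exact h.orth q q'.1 fun hq => hne (Subtype.ext hq.symm)

theorem sumVertex_mul_vertex (h : (enteringGraph H hH).IsCuntzKriegerFamily p s t) {q : Entry H}
    {x : E.Vertex} (hq : entryStart q = x) : sumVertex p x * p q = p q := by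
  rw [sumVertex, Finset.sum_mul, Finset.sum_eq_single_of_mem ⟨q, hq⟩ (Finset.mem_univ _)]
  · exact h.idem q
  · intro q' _ hne
    exact h.orth q'.1 q fun hq => hne (Subtype.ext hq)

theorem sumVertex_of_mem (hH : E.IsHereditary H) {x : E.Vertex} (hx : x ∈ H) :
    sumVertex p x = p (.inl ⟨x, hx⟩) :=
  sum_entryFrom_of_mem hH hx p

/-- In the double sum, different remainders q give different edges (eq)‾, so (CK1) leaves only the
diagonal; there the middle collapses and q̄ q̄* = q remains. -/
theorem sumGhost_mul_sumEdge (h : (enteringGraph H hH).IsCuntzKriegerFamily p s t) (e : E.Edge) :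
    sumGhost p s t e * sumEdge p s t e = sumVertex p (E.range e) := by
  by_cases he : E.source e ∈ H
  · rw [sumGhost_of_mem he, sumEdge_of_mem he, sumVertex_of_mem hH (hH.range_mem he)]
    exact h.ck1_self (.inl ⟨e, he⟩)
  · rw [sumGhost_of_notMem he, sumEdge_of_notMem he, Finset.sum_mul_sum, sumVertex]
    refine Finset.sum_congr rfl fun q _ => ?_
    rw [Finset.sum_eq_single_of_mem q (Finset.mem_univ _)]
    · rw [mul_assoc, ← mul_assoc (t _), h.ghost_cons_mul_edge_cons, h.vertex_finish_mul_ghostEntry,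
        h.entry_mul_ghostEntry]
    · intro q' _ hne
      have h₁ := h.ck1_ne (.inr (EnteringPath.cons e he q.1 q.2))
        (.inr (EnteringPath.cons e he q'.1 q'.2)) fun hq =>
          hne (Subtype.ext (EnteringPath.cons_inj (Sum.inr.inj hq)).2.symm)
      rw [mul_assoc, ← mul_assoc (t _), h₁, zero_mul, mul_zero]

theorem sumGhost_mul_sumEdge_of_ne (h : (enteringGraph H hH).IsCuntzKriegerFamily p s t)
    {e f : E.Edge} (hef : e ≠ f) : sumGhost p s t e * sumEdge p s t f = 0 := by
  by_cases he : E.source e ∈ H <;> by_cases hf : E.source f ∈ H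
  · rw [sumGhost_of_mem he, sumEdge_of_mem hf]
    exact h.ck1_ne _ _ fun h => hef (congrArg Subtype.val (Sum.inl.inj h))
  · rw [sumGhost_of_mem he, sumEdge_of_notMem hf, Finset.mul_sum]
    refine Finset.sum_eq_zero fun q _ => ?_
    rw [← mul_assoc, h.ck1_ne _ _ Sum.inl_ne_inr, zero_mul]
  · rw [sumGhost_of_notMem he, sumEdge_of_mem hf, Finset.sum_mul]
    refine Finset.sum_eq_zero fun q _ => ?_
    rw [mul_assoc, h.ck1_ne _ _ Sum.inr_ne_inl, mul_zero]
  · rw [sumGhost_of_notMem he, sumEdge_of_notMem hf, Finset.sum_mul_sum]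
    refine Finset.sum_eq_zero fun q _ => Finset.sum_eq_zero fun q' _ => ?_
    rw [mul_assoc, ← mul_assoc (t _), h.ck1_ne _ _ fun hq =>
      hef (EnteringPath.cons_inj (Sum.inr.inj hq)).1, zero_mul, mul_zero]

/-- Here the inner factors q̄* q̄' kill the off-diagonal terms, and each diagonal term is the vertex
eq. Summed over the edges at x this becomes (CK2). -/
theorem sumEdge_mul_sumGhost (h : (enteringGraph H hH).IsCuntzKriegerFamily p s t) {e : E.Edge}
    (he : E.source e ∉ H) : sumEdge p s t e * sumGhost p s t e =
      ∑ q : EntryFrom H (E.range e), p (.inr (EnteringPath.cons e he q.1 q.2)) := by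
  rw [sumGhost_of_notMem he, sumEdge_of_notMem he, Finset.sum_mul_sum]
  refine Finset.sum_congr rfl fun q _ => ?_
  rw [Finset.sum_eq_single_of_mem q (Finset.mem_univ _)]
  · rw [mul_assoc, ← mul_assoc (entry p t q), h.ghostEntry_mul_entry, ← mul_assoc,
      h.edge_cons_mul_vertex]
    exact h.entry_mul_ghostEntry (.inr _)
  · intro q' _ hne
    rw [mul_assoc, ← mul_assoc (entry p t q), ghostEntry_mul_entry_of_ne h
      fun hq => hne (Subtype.ext hq.symm), zero_mul, mul_zero]

/-- This is the inductive step showing that the product of the edges along a path into H is sent to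
one edge of E(H). -/
theorem sumEdge_mul_entry (h : (enteringGraph H hH).IsCuntzKriegerFamily p s t) {e : E.Edge}
    (he : E.source e ∉ H) {q : Entry H} (hq : entryStart q = E.range e) :
    sumEdge p s t e * entry p s q = s (.inr (EnteringPath.cons e he q hq)) := by
  rw [sumEdge_of_notMem he, Finset.sum_mul,
    Finset.sum_eq_single_of_mem ⟨q, hq⟩ (Finset.mem_univ _)]
  · rw [mul_assoc, h.ghostEntry_mul_entry, h.edge_cons_mul_vertex]
  · intro q' _ hne
    rw [mul_assoc, ghostEntry_mul_entry_of_ne h fun hq => hne (Subtype.ext hq), mul_zero]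

theorem ghostEntry_mul_sumGhost (h : (enteringGraph H hH).IsCuntzKriegerFamily p s t)
    {e : E.Edge} (he : E.source e ∉ H) {q : Entry H} (hq : entryStart q = E.range e) :
    entry p t q * sumGhost p s t e = t (.inr (EnteringPath.cons e he q hq)) := by
  rw [sumGhost_of_notMem he, Finset.mul_sum,
    Finset.sum_eq_single_of_mem ⟨q, hq⟩ (Finset.mem_univ _)]
  · rw [← mul_assoc, h.ghostEntry_mul_entry, ← entryFinish_cons e he q hq]
    exact h.range_mul (.inr (EnteringPath.cons e he q hq))
  · intro q' _ hne
    rw [← mul_assoc, ghostEntry_mul_entry_of_ne h fun hq => hne (Subtype.ext hq.symm), zero_mul]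

theorem isCuntzKriegerFamily_sum
    (h : (enteringGraph H hH).IsCuntzKriegerFamily p s t) :
    E.IsCuntzKriegerFamily (sumVertex p) (sumEdge p s t) (sumGhost p s t) where
  idem x := by
    nth_rw 2 [sumVertex]
    rw [Finset.mul_sum, sumVertex]
    exact Finset.sum_congr rfl fun q _ => h.sumVertex_mul_vertex q.2
  orth x y hxy := by
    rw [sumVertex, sumVertex, Finset.sum_mul_sum]
    refine Finset.sum_eq_zero fun q _ => Finset.sum_eq_zero fun q' _ => h.orth _ _ fun hq => hxy ?_
    rw [← q.2, ← q'.2, hq]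
  source_mul e := by
    by_cases he : E.source e ∈ H
    · rw [sumEdge_of_mem he, sumVertex_of_mem hH he]
      exact h.source_mul (.inl ⟨e, he⟩)
    · rw [sumEdge_of_notMem he, Finset.mul_sum]
      refine Finset.sum_congr rfl fun q _ => ?_
      have h₁ := h.source_mul (.inr (EnteringPath.cons e he q.1 q.2))
      have h₂ := h.sumVertex_mul_vertex (entryStart_cons e he q.1 q.2)
      rw [← mul_assoc, ← h₁, ← mul_assoc]
      exact congrArg (fun a => a * _ * _) h₂
  mul_range e := by
    by_cases he : E.source e ∈ H
    · rw [sumEdge_of_mem he, sumVertex_of_mem hH (hH.range_mem he)]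
      exact h.mul_range (.inl ⟨e, he⟩)
    · rw [sumEdge_of_notMem he, Finset.sum_mul]
      refine Finset.sum_congr rfl fun q _ => ?_
      rw [mul_assoc, ← h.entry_mul_vertex, mul_assoc, h.vertex_mul_sumVertex q.2]
  range_mul e := by
    by_cases he : E.source e ∈ H
    · rw [sumGhost_of_mem he, sumVertex_of_mem hH (hH.range_mem he)]
      exact h.range_mul (.inl ⟨e, he⟩)
    · rw [sumGhost_of_notMem he, Finset.mul_sum]
      refine Finset.sum_congr rfl fun q _ => ?_
      rw [← mul_assoc, ← h.vertex_mul_entry, ← mul_assoc, h.sumVertex_mul_vertex q.2]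
  mul_source e := by
    by_cases he : E.source e ∈ H
    · rw [sumGhost_of_mem he, sumVertex_of_mem hH he]
      exact h.mul_source (.inl ⟨e, he⟩)
    · rw [sumGhost_of_notMem he, Finset.sum_mul]
      refine Finset.sum_congr rfl fun q _ => ?_
      have h₁ := h.mul_source (.inr (EnteringPath.cons e he q.1 q.2))
      have h₂ := h.vertex_mul_sumVertex (entryStart_cons e he q.1 q.2)
      rw [mul_assoc, ← h₁, mul_assoc]
      exact congrArg (fun a => _ * (_ * a)) h₂
  ck1_self e := h.sumGhost_mul_sumEdge e
  ck1_ne e f hef := h.sumGhost_mul_sumEdge_of_ne hef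
  ck2 x hx := by
    by_cases hxH : x ∈ H
    · have hr := (isRegular_enteringGraph_inl (hH := hH) (x := ⟨x, hxH⟩)).2 hx
      rw [sumVertex_of_mem hH hxH]
      refine (h.ck2 _ hr).trans (sum_enteringGraph_inl hx hr fun e he => ?_).symm
      rw [sumEdge_of_mem he, sumGhost_of_mem he]
    · exact (sum_entryFrom_of_notMem hH hxH _ (fun e => hx.1.mem_toFinset) p _ fun e he =>
        h.sumEdge_mul_sumGhost (he.symm ▸ hxH)).symm

end Entering

/-! ### The E(H)-family built from an E-family -/

section Path

variable {E : DirectedGraph.{u, v}} {H : Set E.Vertex} {A : Type*} [NonUnitalRing A]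
  {p : E.Vertex → A} {s t : E.Edge → A}

/-- The product `s e₁ ⋯ s eₙ` of a path into `H` in a Cuntz–Krieger `E`-family. -/
def path (p : E.Vertex → A) (s : E.Edge → A) (q : Entry H) : A :=
  (entryEdges q).foldr (fun e a => s e * a) (p (entryFinish q))

/-- The product `t eₙ ⋯ t e₁` of a path into `H` in a Cuntz–Krieger `E`-family. -/
def ghostPath (p : E.Vertex → A) (t : E.Edge → A) (q : Entry H) : A :=
  (entryEdges q).foldr (fun e a => a * t e) (p (entryFinish q))

/-- The vertices of `E(H)` in a Cuntz–Krieger `E`-family. -/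
def pathVertex (p : E.Vertex → A) (s t : E.Edge → A) (q : Entry H) : A :=
  path p s q * ghostPath p t q

/-- The edges of `E(H)` in a Cuntz–Krieger `E`-family. -/
def pathEdge (p : E.Vertex → A) (s : E.Edge → A) :
    {e : E.Edge // E.source e ∈ H} ⊕ EnteringPath H → A :=
  Sum.elim (fun e => s e) fun α => path p s (.inr α)

/-- The ghost edges of `E(H)` in a Cuntz–Krieger `E`-family. -/
def pathGhostEdge (p : E.Vertex → A) (t : E.Edge → A) :
    {e : E.Edge // E.source e ∈ H} ⊕ EnteringPath H → A :=
  Sum.elim (fun e => t e) fun α => ghostPath p t (.inr α)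

theorem path_cons (e : E.Edge) (he : E.source e ∉ H) (q : Entry H)
    (hq : entryStart q = E.range e) :
    path p s (.inr (EnteringPath.cons e he q hq)) = s e * path p s q := by
  rw [path, entryFinish_cons, entryEdges, EnteringPath.cons_edges]
  rfl

theorem ghostPath_cons (e : E.Edge) (he : E.source e ∉ H) (q : Entry H)
    (hq : entryStart q = E.range e) :
    ghostPath p t (.inr (EnteringPath.cons e he q hq)) = ghostPath p t q * t e := by
  rw [ghostPath, entryFinish_cons, entryEdges, EnteringPath.cons_edges]
  rfl

theorem vertex_mul_path (h : E.IsCuntzKriegerFamily p s t) (hH : E.IsHereditary H) (q : Entry H) :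
    p (entryStart q) * path p s q = path p s q := by
  rcases q with x | α
  · exact h.idem x
  · obtain ⟨e, he, q, hq, rfl⟩ := α.exists_cons hH
    rw [path_cons, entryStart_cons, ← mul_assoc, h.source_mul]

theorem ghostPath_mul_vertex (h : E.IsCuntzKriegerFamily p s t) (hH : E.IsHereditary H)
    (q : Entry H) : ghostPath p t q * p (entryStart q) = ghostPath p t q := by
  rcases q with x | α
  · exact h.idem x
  · obtain ⟨e, he, q, hq, rfl⟩ := α.exists_cons hH
    rw [ghostPath_cons, entryStart_cons, mul_assoc, h.mul_source]

theorem path_mul_vertex (h : E.IsCuntzKriegerFamily p s t) (hH : E.IsHereditary H) (q : Entry H) :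
    path p s q * p (entryFinish q) = path p s q := by
  induction q using entry_induction hH with
  | vertex x => exact h.idem x
  | cons e he q hq ih => rw [path_cons, entryFinish_cons, mul_assoc, ih]

theorem vertex_mul_ghostPath (h : E.IsCuntzKriegerFamily p s t) (hH : E.IsHereditary H)
    (q : Entry H) : p (entryFinish q) * ghostPath p t q = ghostPath p t q := by
  induction q using entry_induction hH with
  | vertex x => exact h.idem x
  | cons e he q hq ih => rw [ghostPath_cons, entryFinish_cons, ← mul_assoc, ih]

theorem ghostPath_mul_path (h : E.IsCuntzKriegerFamily p s t) (hH : E.IsHereditary H)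
    (q : Entry H) : ghostPath p t q * path p s q = p (entryFinish q) := by
  induction q using entry_induction hH with
  | vertex x => exact h.idem x
  | cons e he q hq ih =>
    rw [ghostPath_cons, path_cons, entryFinish_cons, mul_assoc, ← mul_assoc (t e), h.ck1_self,
      ← hq, h.vertex_mul_path hH, ih]

theorem ghostPath_mul_path_of_start_ne (h : E.IsCuntzKriegerFamily p s t) (hH : E.IsHereditary H)
    {q q' : Entry H} (hq : entryStart q ≠ entryStart q') : ghostPath p t q * path p s q' = 0 := by
  rw [← h.ghostPath_mul_vertex hH, ← h.vertex_mul_path hH q', mul_assoc, ← mul_assoc (p _),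
    h.orth _ _ hq, zero_mul, mul_zero]

/-- A path into H meets H only at its last vertex, so two different ones either start at different
vertices or diverge at some edge. Cancelling common first edges leads to one of these cases, where
orthogonality or (CK1) gives zero. -/
theorem ghostPath_mul_path_of_ne (h : E.IsCuntzKriegerFamily p s t) (hH : E.IsHereditary H)
    {q q' : Entry H} (hq : q ≠ q') : ghostPath p t q * path p s q' = 0 := by
  induction q using entry_induction hH generalizing q' with
  | vertex x =>
    refine h.ghostPath_mul_path_of_start_ne hH fun hx => hq ?_
    exact (eq_inl_of_entryStart hH x.2 hx.symm).symm
  | cons e he q hqe ih =>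
    rcases q' with x | α
    · exact h.ghostPath_mul_path_of_start_ne hH fun hx =>
        hq (eq_inl_of_entryStart hH x.2 hx)
    · obtain ⟨f, hf, q', hqf, rfl⟩ := α.exists_cons hH
      rw [ghostPath_cons, path_cons, mul_assoc, ← mul_assoc (t e)]
      by_cases hef : e = f
      · subst hef
        rw [h.ck1_self, ← hqf, h.vertex_mul_path hH]
        exact ih fun hqq => hq (by subst hqq; rfl)
      · rw [h.ck1_ne e f hef, zero_mul, mul_zero]

theorem pathVertex_inl (h : E.IsCuntzKriegerFamily p s t) (x : {x : E.Vertex // x ∈ H}) :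
    pathVertex p s t (.inl x) = p x :=
  h.idem x

theorem pathVertex_mul_path (h : E.IsCuntzKriegerFamily p s t) (hH : E.IsHereditary H)
    (q : Entry H) : pathVertex p s t q * path p s q = path p s q := by
  rw [pathVertex, mul_assoc, h.ghostPath_mul_path hH, h.path_mul_vertex hH]

theorem ghostPath_mul_pathVertex (h : E.IsCuntzKriegerFamily p s t) (hH : E.IsHereditary H)
    (q : Entry H) : ghostPath p t q * pathVertex p s t q = ghostPath p t q := by
  rw [pathVertex, ← mul_assoc, h.ghostPath_mul_path hH, h.vertex_mul_ghostPath hH]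

theorem ghost_mul_path_of_mem (h : E.IsCuntzKriegerFamily p s t) (hH : E.IsHereditary H)
    {e : E.Edge} (he : E.source e ∈ H) (α : EnteringPath H) : t e * path p s (.inr α) = 0 := by
  rw [← h.mul_source, ← h.vertex_mul_path hH, mul_assoc, ← mul_assoc (p _), h.orth _ _, zero_mul,
    mul_zero]
  exact fun hx => entryStart_notMem hH α (hx ▸ he)

theorem ghostPath_mul_edge_of_mem (h : E.IsCuntzKriegerFamily p s t) (hH : E.IsHereditary H)
    {e : E.Edge} (he : E.source e ∈ H) (α : EnteringPath H) :
    ghostPath p t (.inr α) * s e = 0 := by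
  rw [← h.source_mul, ← h.ghostPath_mul_vertex hH, mul_assoc, ← mul_assoc (p _), h.orth _ _,
    zero_mul, mul_zero]
  exact fun hx => entryStart_notMem hH α (hx ▸ he)

theorem isCuntzKriegerFamily_path (h : E.IsCuntzKriegerFamily p s t) (hH : E.IsHereditary H) :
    (enteringGraph H hH).IsCuntzKriegerFamily (pathVertex p s t) (pathEdge p s)
      (pathGhostEdge p t) where
  idem q := by
    exact (mul_assoc _ _ _).symm.trans
      (congrArg (fun a => a * ghostPath p t q) (h.pathVertex_mul_path hH q))
  orth q q' hq := by
    change path p s q * ghostPath p t q * (path p s q' * ghostPath p t q') = 0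
    rw [mul_assoc, ← mul_assoc (ghostPath p t q),
      h.ghostPath_mul_path_of_ne hH hq, zero_mul, mul_zero]
  source_mul
    | .inl e => (congrArg (fun a => a * s e) (h.pathVertex_inl ⟨_, e.2⟩)).trans (h.source_mul e)
    | .inr α => h.pathVertex_mul_path hH (.inr α)
  mul_range
    | .inl e => (congrArg (fun a => s e * a) (h.pathVertex_inl ⟨_, hH.range_mem e.2⟩)).trans
        (h.mul_range e)
    | .inr α => (congrArg (fun a => path p s (.inr α) * a) (h.pathVertex_inl _)).trans
        (h.path_mul_vertex hH (.inr α))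
  range_mul
    | .inl e => (congrArg (fun a => a * t e) (h.pathVertex_inl ⟨_, hH.range_mem e.2⟩)).trans
        (h.range_mul e)
    | .inr α => (congrArg (fun a => a * ghostPath p t (.inr α)) (h.pathVertex_inl _)).trans
        (h.vertex_mul_ghostPath hH (.inr α))
  mul_source
    | .inl e => (congrArg (fun a => t e * a) (h.pathVertex_inl ⟨_, e.2⟩)).trans (h.mul_source e)
    | .inr α => h.ghostPath_mul_pathVertex hH (.inr α)
  ck1_self
    | .inl e => (h.ck1_self e).trans (h.pathVertex_inl ⟨_, hH.range_mem e.2⟩).symm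
    | .inr α => (h.ghostPath_mul_path hH (.inr α)).trans (h.pathVertex_inl _).symm
  ck1_ne
    | .inl e, .inl f, hef => h.ck1_ne e f fun hh => hef (congrArg Sum.inl (Subtype.ext hh))
    | .inl e, .inr α, _ => h.ghost_mul_path_of_mem hH e.2 α
    | .inr α, .inl e, _ => h.ghostPath_mul_edge_of_mem hH e.2 α
    | .inr α, .inr β, hef => h.ghostPath_mul_path_of_ne hH fun hh =>
        hef (congrArg Sum.inr (Sum.inr.inj hh))
  ck2
    | .inl x, hr => by
      have hx := isRegular_enteringGraph_inl.1 hr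
      rw [h.pathVertex_inl, h.ck2 _ hx]
      exact sum_enteringGraph_inl hx hr fun e he => rfl
    -- The only edge at the vertex α is ᾱ, and `pathVertex` is by definition the resulting single
    -- term.
    | .inr α, hr => by
      rw [Finset.sum_eq_single_of_mem (.inr α) (hr.1.mem_toFinset.2 rfl)]
      · rfl
      · rintro (e | β) he hne
        · exact absurd (hr.1.mem_toFinset.1 he) Sum.inl_ne_inr
        · exact absurd (congrArg Sum.inr (Sum.inr.inj (hr.1.mem_toFinset.1 he))) hne

/-- Apply (CK2) at x, then again at the ranges outside H; acyclicity and finiteness make every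
branch end in H. -/
theorem sum_pathVertex [∀ x, Fintype (EntryFrom H x)] (h : E.IsCuntzKriegerFamily p s t)
    (hH : E.IsHereditary H) (hfin : (outside H hH).IsFinite)
    (hacyclic : (outside H hH).IsAcyclic) (hreg : ∀ x ∉ H, E.IsRegular x) (x : E.Vertex) :
    ∑ q : EntryFrom H x, pathVertex p s t q.1 = p x := by
  induction x using induction_outside hH hfin hacyclic with
  | mem x hx => exact (sum_entryFrom_of_mem hH hx (pathVertex p s t)).trans (h.pathVertex_inl _)
  | notMem x hx ih =>
    rw [h.ck2 x (hreg x hx)]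
    refine (sum_entryFrom_of_notMem hH hx _ (fun e => (hreg x hx).1.mem_toFinset) _ _
      fun e he => ?_).symm
    simp only [pathVertex, path_cons, ghostPath_cons]
    -- Insert r(e) between e and e*, and expand it by the induction hypothesis: e e* = ∑ (eq)(eq)*.
    nth_rw 1 [← h.mul_range, ← ih e he, Finset.mul_sum, Finset.sum_mul]
    refine Finset.sum_congr rfl fun q _ => ?_
    simp only [pathVertex, mul_assoc]

end Path

end IsCuntzKriegerFamily

end DirectedGraph

/-! ### The two homomorphisms are mutually inverse -/

namespace LeavittPathAlgebra

/-- An endomorphism of `L_R(E)` that fixes the generators is the identity. -/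
theorem eq_self_of_generators {R : Type w} [CommRing R] {E : DirectedGraph.{u, v}}
    (φ : LeavittPathAlgebra R E →ₙₐ[R] LeavittPathAlgebra R E)
    (hp : ∀ x, φ (vertex R E x) = vertex R E x) (hs : ∀ e, φ (edge R E e) = edge R E e)
    (ht : ∀ e, φ (ghost R E e) = ghost R E e) (a : LeavittPathAlgebra R E) : φ a = a :=
  DFunLike.congr_fun ((existsUnique_lift R E (isCuntzKriegerFamily R E)).unique
    (y₂ := NonUnitalAlgHom.id R _) ⟨hp, hs, ht⟩ ⟨fun _ => rfl, fun _ => rfl, fun _ => rfl⟩) a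

end LeavittPathAlgebra

open IsCuntzKriegerFamily in
theorem mainTheorem8 {R : Type w} [CommRing R] (E : DirectedGraph.{u, v}) (H : Set E.Vertex)
    (hH : E.IsHereditary H)
    (hfin : (outside H hH).IsFinite) (hacyclic : (outside H hH).IsAcyclic)
    (hreach : ∀ x, x ∉ H → ∃ y ∈ H, E.Reaches x y)
    (hentering : {e : E.Edge | E.source e ∉ H ∧ E.range e ∈ H}.Finite) :
    ∃ φ : LeavittPathAlgebra R E →ₙₐ[R] LeavittPathAlgebra R (enteringGraph H hH),
      Function.Bijective φ := by
  have hreg : ∀ x ∉ H, E.IsRegular x := fun x => isRegular_of_notMem hH hfin hreach hentering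
  have (x : E.Vertex) : Finite (EntryFrom H x) := finite_entryFrom hH hfin hacyclic hreg x
  have (x : E.Vertex) : Fintype (EntryFrom H x) := .ofFinite _
  have hE := LeavittPathAlgebra.isCuntzKriegerFamily R E
  have hG := LeavittPathAlgebra.isCuntzKriegerFamily R (enteringGraph H hH)
  obtain ⟨φ, ⟨φp, φs, φt⟩, -⟩ :=
    LeavittPathAlgebra.existsUnique_lift R _ hG.isCuntzKriegerFamily_sum
  obtain ⟨ψ, ⟨ψp, ψs, ψt⟩, -⟩ :=
    LeavittPathAlgebra.existsUnique_lift R _ (hE.isCuntzKriegerFamily_path hH)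
  have ψentry (q : Entry H) : ψ (entry (LeavittPathAlgebra.vertex R (enteringGraph H hH))
      (LeavittPathAlgebra.edge R (enteringGraph H hH)) q) =
      path (LeavittPathAlgebra.vertex R E) (LeavittPathAlgebra.edge R E) q := by
    rcases q with x | α
    · exact (ψp (.inl x)).trans (hE.pathVertex_inl x)
    · exact ψs (.inr α)
  have ψghostEntry (q : Entry H) : ψ (entry (LeavittPathAlgebra.vertex R (enteringGraph H hH))
      (LeavittPathAlgebra.ghost R (enteringGraph H hH)) q) =
      ghostPath (LeavittPathAlgebra.vertex R E) (LeavittPathAlgebra.ghost R E) q := by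
    rcases q with x | α
    · exact (ψp (.inl x)).trans (hE.pathVertex_inl x)
    · exact ψt (.inr α)
  have φpath (q : Entry H) :
      φ (path (LeavittPathAlgebra.vertex R E) (LeavittPathAlgebra.edge R E) q) =
      entry (LeavittPathAlgebra.vertex R (enteringGraph H hH))
        (LeavittPathAlgebra.edge R (enteringGraph H hH)) q := by
    induction q using entry_induction hH with
    | vertex x => exact (φp x).trans (sumVertex_of_mem hH x.2)
    | cons e he q hq ih => rw [path_cons, map_mul, ih, φs, hG.sumEdge_mul_entry he]; rfl
  have φghostPath (q : Entry H) :
      φ (ghostPath (LeavittPathAlgebra.vertex R E) (LeavittPathAlgebra.ghost R E) q) =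
      entry (LeavittPathAlgebra.vertex R (enteringGraph H hH))
        (LeavittPathAlgebra.ghost R (enteringGraph H hH)) q := by
    induction q using entry_induction hH with
    | vertex x => exact (φp x).trans (sumVertex_of_mem hH x.2)
    | cons e he q hq ih => rw [ghostPath_cons, map_mul, ih, φt, hG.ghostEntry_mul_sumGhost he]; rfl
  have hψφ : ∀ a, ψ (φ a) = a := by
    refine LeavittPathAlgebra.eq_self_of_generators (ψ.comp φ) (fun x => ?_) (fun e => ?_)
      fun e => ?_
    · rw [NonUnitalAlgHom.comp_apply, φp]
      exact ((map_sum ψ _ _).trans (Finset.sum_congr rfl fun q _ => ψp q.1)).trans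
        (hE.sum_pathVertex hH hfin hacyclic hreg x)
    · rw [NonUnitalAlgHom.comp_apply, φs]
      by_cases he : E.source e ∈ H
      · exact (congrArg ψ (sumEdge_of_mem he)).trans (ψs (.inl ⟨e, he⟩))
      · refine ((congrArg ψ (sumEdge_of_notMem he)).trans (map_sum ψ _ _)).trans ?_
        -- Write e = e r(e) = ∑ e q q*; the term for q is the image under `ψ` of (eq)‾ q̄*.
        rw [← hE.mul_range, ← hE.sum_pathVertex hH hfin hacyclic hreg, Finset.mul_sum]
        refine Finset.sum_congr rfl fun q _ => (map_mul ψ _ _).trans ?_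
        exact (congrArg₂ (fun a b => a * b) ((ψs (.inr _)).trans (path_cons e he q.1 q.2))
          (ψghostEntry q.1)).trans (mul_assoc _ _ _)
    · rw [NonUnitalAlgHom.comp_apply, φt]
      by_cases he : E.source e ∈ H
      · exact (congrArg ψ (sumGhost_of_mem he)).trans (ψt (.inl ⟨e, he⟩))
      · refine ((congrArg ψ (sumGhost_of_notMem he)).trans (map_sum ψ _ _)).trans ?_
        rw [← hE.range_mul, ← hE.sum_pathVertex hH hfin hacyclic hreg, Finset.sum_mul]
        refine Finset.sum_congr rfl fun q _ => (map_mul ψ _ _).trans ?_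
        exact (congrArg₂ (fun a b => a * b) (ψentry q.1)
          ((ψt (.inr _)).trans (ghostPath_cons e he q.1 q.2))).trans (mul_assoc _ _ _).symm
  have hφψ : ∀ a, φ (ψ a) = a := by
    refine LeavittPathAlgebra.eq_self_of_generators (φ.comp ψ) (fun q => ?_) (fun e => ?_)
      fun e => ?_
    · rw [NonUnitalAlgHom.comp_apply, ψp]
      -- The image of q q* under `φ` is q̄ q̄*, which is the vertex q by (CK2) in E(H), or by
      -- idempotence if q lies in H.
      exact ((map_mul φ _ _).trans (congrArg₂ (fun a b => a * b) (φpath q) (φghostPath q))).trans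
        (hG.entry_mul_ghostEntry q)
    · rw [NonUnitalAlgHom.comp_apply, ψs]
      rcases e with e | α
      · exact (φs e).trans (sumEdge_of_mem e.2)
      · exact φpath (.inr α)
    · rw [NonUnitalAlgHom.comp_apply, ψt]
      rcases e with e | α
      · exact (φt e).trans (sumGhost_of_mem e.2)
      · exact φghostPath (.inr α)
  exact ⟨φ, Function.bijective_iff_has_inverse.2 ⟨ψ, hψφ, hφψ⟩⟩
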